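/- **Conventions.** Let $\Lambda,\Omega$ be countably infinite sets and let $\mathcal F$ be a nonempty family of infinite subsets of $\Omega$ such that $F\setminus K\in\mathcal F$ for every $F\in\mathcal F$ and every finite $K\subseteq\Omega$. A function $\rho$ from $\mathcal F$ to the family of infinite subsets of $\Lambda$ is *partition regular* if - (M) $E\subseteq F$ implies $\rho(E)\subseteq\rho(F)$ for all $E,F\in\mathcal F$; - (R) whenever $F\in\mathcal F$ and $\rho(F)=A\cup B$, there is $E\in\mathcal F$ with $\rho(E)\subseteq A$ or $\rho(E)\subseteq B$; - (S) for every $E\in\mathcal F$ there is $F\in\mathcal F$ with $F\subseteq E$ such that for every $a\in\rho(F)$ there is a finite $K\subseteq\Omega$ with $a\notin\rho(F\setminus K)$. $\mathrm{FinBW}(\rho)$ is the class of all topological spaces $Y$ such that for every $f:\Lambda\to Y$ there are $F\in\mathcal F$ and $y\in Y$ such that for every neighbourhood $U$ of $y$ there is a finite $K\subseteq\Omega$ with $f[\rho(F\setminus K)]\subseteq U$. For partition regular $\rho_i$, defined on families $\mathcal F_i$ of subsets of $\Omega_i$ with values subsets of $\Lambda_i$ ($i=1,2$), $\rho_2\le_K\rho_1$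 means that there is $f:\Lambda_1\to\Lambda_2$ such that for every $F_1\in\mathcal F_1$ there is $F_2\in\mathcal F_2$ such that for every finite $K_1\subseteq\Omega_1$ there is a finite $K_2\subseteq\Omega_2$ with $\rho_2(F_2\setminus K_2)\subseteq f[\rho_1(F_1\setminus K_1)]$. **The function $\rho^{[0,1]}$.** Let $\mathrm{conv}$ be the family of all subsets of $\mathbb Q\cap[0,1]$ that can be covered by the ranges of finitely many sequences in $\mathbb Q\cap[0,1]$ which converge in $[0,1]$. Let $X$ be the set of all injections $x:\omega\times\omega\to\mathbb Q\cap[0,1]$ such that $x[(\omega\setminus[0,n])\times\omega]\notin\mathrm{conv}$ for all $n\in\omega$, and every $p\in[0,1]$ has a neighbourhood $U$ with $x[(\omega\setminus[0,n])\times\omega]\not\subseteq U$ for all $n\in\omega$. Let $(A_\alpha)_{\alpha\in I}$ be any family of infinite subsets of $\omega$ with $A_\alpha\cap A_\beta$ finite for $\alpha\ne\beta$, indexed by a set $I$ (for instance the cardinal $\mathfrak c$), and let $X=\{x_\alpha:\alpha\in I\}$ be any enumeration of $X$. Define $\rho^{[0,1]}$ on $\{A_\alpha\setminus K:\alpha\in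 I,\ K\subseteq\omega\text{ finite}\}$ by $$\rho^{[0,1]}(A_\alpha\setminus K)=x_\alpha\big[(\omega\setminus[0,\max(A_\alpha\cap K)])\times\omega\big],$$ where $[0,\max\emptyset]=\emptyset$. **Theorem.** The function $\rho^{[0,1]}$ is partition regular, and for every partition regular function $\rho$ the following conditions are equivalent. 1. For every metric space $Y$: $Y\in\mathrm{FinBW}(\rho)$ if and only if $Y$ is compact. 2. $[0,1]\in\mathrm{FinBW}(\rho)$. 3. $\rho^{[0,1]}\not\le_K\rho$. -/

import Mathlib

open Filter Topology Set

/-- A map `ρ` defined on a family `dom` of subsets of `Ω`, with subsets of `Λ` as values.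
The map is stored as a total function; only its values on members of `dom` matter. -/
structure FamilyMap (Ω : Type*) (Λ : Type*) where
  /-- the family on which the map is defined -/
  dom : Set (Set Ω)
  /-- the map -/
  map : Set Ω → Set Λ

namespace FamilyMap

variable {Ω Λ : Type*}

/-- Partition regular functions `ρ : 𝓕 → [Λ]^ω` with `𝓕 ⊆ [Ω]^ω`. -/
structure IsPartitionRegular (ρ : FamilyMap Ω Λ) : Prop where
  countable_source : Countable Ω
  infinite_source : Infinite Ω
  countable_target : Countable Λ
  infinite_target : Infinite Λ
  dom_nonempty : ρ.dom.Nonempty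
  infinite_of_mem : ∀ F ∈ ρ.dom, F.Infinite
  diff_mem : ∀ F ∈ ρ.dom, ∀ K : Set Ω, K.Finite → F \ K ∈ ρ.dom
  map_infinite : ∀ F ∈ ρ.dom, (ρ.map F).Infinite
  /-- condition (M) -/
  mono : ∀ E ∈ ρ.dom, ∀ F ∈ ρ.dom, E ⊆ F → ρ.map E ⊆ ρ.map F
  /-- condition (R) -/
  regular : ∀ F ∈ ρ.dom, ∀ A B : Set Λ, ρ.map F = A ∪ B →
    ∃ E ∈ ρ.dom, ρ.map E ⊆ A ∨ ρ.map E ⊆ B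
  /-- condition (S) -/
  sparse : ∀ E ∈ ρ.dom, ∃ F ∈ ρ.dom, F ⊆ E ∧
    ∀ a ∈ ρ.map F, ∃ K : Set Ω, K.Finite ∧ a ∉ ρ.map (F \ K)

/-- `f ↾ ρ(F)` is `ρ`-convergent to `y`. -/
def ConvergesTo (ρ : FamilyMap Ω Λ) {Y : Type*} [TopologicalSpace Y]
    (f : Λ → Y) (F : Set Ω) (y : Y) : Prop :=
  ∀ U ∈ 𝓝 y, ∃ K : Set Ω, K.Finite ∧ f '' ρ.map (F \ K) ⊆ U

/-- The space `Y` belongs to `FinBW(ρ)`. -/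
def FinBW (ρ : FamilyMap Ω Λ) (Y : Type*) [TopologicalSpace Y] : Prop :=
  ∀ f : Λ → Y, ∃ F ∈ ρ.dom, ∃ y : Y, ρ.ConvergesTo f F y

/-- The Katětov order: `KatetovLE ρ₂ ρ₁` means `ρ₂ ≤_K ρ₁`. -/
def KatetovLE {Ω₂ Λ₂ Ω₁ Λ₁ : Type*} (ρ₂ : FamilyMap Ω₂ Λ₂) (ρ₁ : FamilyMap Ω₁ Λ₁) : Prop :=
  ∃ f : Λ₁ → Λ₂, ∀ F₁ ∈ ρ₁.dom, ∃ F₂ ∈ ρ₂.dom,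
    ∀ K₁ : Set Ω₁, K₁.Finite → ∃ K₂ : Set Ω₂, K₂.Finite ∧
      ρ₂.map (F₂ \ K₂) ⊆ f '' ρ₁.map (F₁ \ K₁)

end FamilyMap

/-- The set `ℚ ∩ [0,1]`, as a subset of the unit interval. -/
def ratUnit : Set unitInterval := {t | ∃ q : ℚ, (q : ℝ) = (t : ℝ)}

/-- Membership in the ideal `conv` on `ℚ ∩ [0,1]`: the set is covered by the ranges of finitely
many sequences in `ℚ ∩ [0,1]` that converge in `[0,1]`. -/
def MemConv (B : Set ratUnit) : Prop :=
  ∃ (m : ℕ) (s : Fin m → ℕ → ratUnit),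
    (∀ i, ∃ p : unitInterval, Tendsto (fun k => (s i k : unitInterval)) atTop (𝓝 p)) ∧
    B ⊆ ⋃ i, range (s i)

/-- The family of all injections `x : ω × ω → ℚ ∩ [0,1]` whose sets
`x[(ω ∖ [0,n]) × ω]`, `n ∈ ω`, do not belong to `conv` and such that every point of `[0,1]` has a
neighbourhood that contains none of these sets. -/
def spreadInjections : Set (ℕ × ℕ → ratUnit) :=
  {x | (∀ p : unitInterval, ∃ U ∈ 𝓝 p, ∀ n : ℕ,
          ¬ (fun z => (x z : unitInterval)) '' {z : ℕ × ℕ | n < z.1} ⊆ U) ∧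
       Function.Injective x ∧
       ∀ n : ℕ, ¬ MemConv (x '' {z : ℕ × ℕ | n < z.1})}

/-- `(A α)` is an (injectively indexed) almost disjoint family of infinite subsets of `ω`. -/
def IsAlmostDisjointFamily {ι : Type*} (A : ι → Set ℕ) : Prop :=
  (∀ α, (A α).Infinite) ∧ ∀ α β, α ≠ β → (A α ∩ A β).Finite

/-- The function `ρ^{[0,1]}` determined by the almost disjoint family `(A α)` and the enumeration
`(x α)`: it is defined on the sets `A α ∖ K` with `K` finite, and sends `A α ∖ K` to
`x α [(ω ∖ [0, max (A α ∩ K)]) × ω]`, which is all of `x α [ω × ω]` if `A α ∩ K = ∅`. -/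
def rhoUnit {ι : Type*} (A : ι → Set ℕ) (x : ι → ℕ × ℕ → ratUnit) : FamilyMap ℕ ratUnit where
  dom := {E | ∃ (α : ι) (K : Set ℕ), K.Finite ∧ E = A α \ K}
  map E := {q | ∃ (α : ι) (K : Set ℕ), K.Finite ∧ E = A α \ K ∧
    q ∈ x α '' {z : ℕ × ℕ | ∀ m ∈ A α ∩ K, m < z.1}}

/-- For an almost disjoint family, the value at `A α ∖ K` does not depend on how that set is
represented. -/
theorem rhoUnit_map_diff {ι : Type*} {A : ι → Set ℕ} (hA : IsAlmostDisjointFamily A)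
    (x : ι → ℕ × ℕ → ratUnit) (α : ι) {K : Set ℕ} (hK : K.Finite) :
    (rhoUnit A x).map (A α \ K) = x α '' {z : ℕ × ℕ | ∀ m ∈ A α ∩ K, m < z.1} := by
  ext q
  constructor
  · rintro ⟨β, L, hL, hE, hq⟩
    have hαβ : α = β := by
      by_contra hne
      refine ((hA.1 α).sdiff hK) ((hA.2 α β hne).subset fun m hm => ⟨hm.1, ?_⟩)
      rw [hE] at hm
      exact hm.1
    subst hαβ
    have hKL : A α ∩ K = A α ∩ L := by
      rw [← sdiff_sdiff_right_self, ← sdiff_sdiff_right_self]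
      rw [hE]
    rwa [hKL]
  · intro hq
    exact ⟨α, K, hK, rfl, hq⟩

/-! A subset of `ℚ ∩ [0,1]` is in `conv` exactly when it has finitely many accumulation points
(`memConv_iff`). Any set outside `conv` therefore contains the range of a spread injection, which
gives (R) for `rhoUnit`.

If `[0,1]` is not in `FinBW(ρ)`, a bad function can be perturbed to an injection `g` into the
rationals. No `g[ρ(F)]` is in `conv`: otherwise (R) would put some `g[ρ(E)]` inside one convergent
sequence, and (S) would make `g` converge. So, after thinning by (S), the images of the tails of `F`
have infinitely many accumulation points and do not shrink to any point. A spread injection `x α`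
can be threaded through them (`exists_mem_spreadInjections`), and `g` witnesses `ρ^{[0,1]} ≤_K ρ`.

Conversely, if a Katětov reduction converged to `p` along some `F`, every neighbourhood of `p` would
contain a tail of one fixed `x α`, which spread injections forbid. General compact metric spaces
reduce to `[0,1]` through the Cantor set. -/

/-- A countably indexed family of infinite sets has an injective choice function. -/
theorem exists_injective_mem_of_infinite {ι X : Type*} [Countable ι] {T : ι → Set X}
    (hT : ∀ i, (T i).Infinite) : ∃ f : ι → X, Function.Injective f ∧ ∀ i, f i ∈ T i := by
  classical
  rcases isEmpty_or_nonempty ι with h | h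
  · exact ⟨fun i => h.elim i, fun i => h.elim i, fun i => h.elim i⟩
  obtain ⟨e, he⟩ := exists_injective_nat ι
  have step : ∀ (n : ℕ) (s : Finset X), ∃ a, a ∈ T (Function.invFun e n) ∧ a ∉ s :=
    fun n s => (hT _).exists_notMem_finset s
  choose c hc using step
  let g : ℕ → X := fun n => Nat.strongRec (motive := fun _ => X)
    (fun n ih => c n (Finset.univ.image fun m : Fin n => ih m m.2)) n
  have hg : ∀ n, g n = c n (Finset.univ.image fun m : Fin n => g m) := fun n => by
    simp only [g]
    rw [Nat.strongRec_eq]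
  have hne : ∀ m n, m < n → g m ≠ g n := by
    intro m n hmn h
    have := (hc n (Finset.univ.image fun m : Fin n => g m)).2
    rw [← hg n, ← h] at this
    exact this (Finset.mem_image.2 ⟨⟨m, hmn⟩, Finset.mem_univ _, rfl⟩)
  refine ⟨fun i => g (e i), fun i j hij => he ?_, fun i => ?_⟩
  · by_contra hcon
    rcases lt_or_gt_of_ne hcon with h | h
    · exact hne _ _ h hij
    · exact hne _ _ h hij.symm
  · have := (hc (e i) (Finset.univ.image fun m : Fin (e i) => g m)).1
    rw [← hg, Function.leftInverse_invFun he i] at this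
    exact this

/-! ### Accumulation points and the ideal `conv` -/

/-- The points of `[0,1]` all of whose neighbourhoods contain infinitely many elements of `S`. -/
def accPts (S : Set ratUnit) : Set unitInterval :=
  {p | ∀ U ∈ 𝓝 p, {q : ratUnit | q ∈ S ∧ (q : unitInterval) ∈ U}.Infinite}

theorem accPts_mono {S T : Set ratUnit} (h : S ⊆ T) : accPts S ⊆ accPts T :=
  fun _ hp U hU => (hp U hU).mono fun _ hq => ⟨h hq.1, hq.2⟩

theorem exists_mem_accPts {S : Set ratUnit} (hS : S.Infinite) : ∃ p, p ∈ accPts S := by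
  by_contra! hcon
  simp only [accPts, mem_ofPred_eq, not_forall, Set.not_infinite] at hcon
  choose U hU hfin using hcon
  obtain ⟨t, ht⟩ := CompactSpace.elim_nhds_subcover U hU
  refine hS ((t.finite_toSet.biUnion fun p _ => hfin p).subset fun q hq => ?_)
  have : (q : unitInterval) ∈ ⋃ p ∈ t, U p := by rw [ht]; trivial
  simp only [mem_iUnion, Finset.mem_coe] at this ⊢
  obtain ⟨p, hp, hqp⟩ := this
  exact ⟨p, hp, hq, hqp⟩

theorem dense_ratUnit : Dense ratUnit := by
  refine dense_of_exists_between fun a b hab => ?_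
  obtain ⟨q, hq⟩ := exists_rat_btwn (Subtype.coe_lt_coe.2 hab)
  exact ⟨⟨q, a.2.1.trans hq.1.le, hq.2.le.trans b.2.2⟩, ⟨q, rfl⟩, hq.1, hq.2⟩

theorem accPts_univ : accPts univ = univ := by
  refine eq_univ_of_forall fun p U hU hfin => ?_
  obtain ⟨V, hVU, hV, hpV⟩ := mem_nhds_iff.1 hU
  obtain ⟨q, hqV, hq, hqn⟩ := (dense_ratUnit.sdiff_finite (hfin.image Subtype.val)).inter_open_nonempty
    V hV ⟨p, hpV⟩
  exact hqn ⟨⟨q, hq⟩, ⟨trivial, hVU hqV⟩, rfl⟩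

theorem countable_ratUnit : Countable ratUnit := by
  choose f hf using fun t : ratUnit => t.2
  exact Function.Injective.countable (f := f) fun a b hab => by
    apply Subtype.ext; apply Subtype.ext
    rw [← hf a, ← hf b, hab]

theorem finite_range_diff_of_tendsto {s : ℕ → ratUnit} {p : unitInterval}
    (h : Tendsto (fun k => (s k : unitInterval)) atTop (𝓝 p)) {U : Set unitInterval}
    (hU : U ∈ 𝓝 p) : {q : ratUnit | q ∈ range s ∧ (q : unitInterval) ∉ U}.Finite := by
  obtain ⟨N, hN⟩ := eventually_atTop.1 (h.eventually_mem hU)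
  refine ((finite_Iio N).image s).subset ?_
  rintro _ ⟨⟨k, rfl⟩, hk⟩
  exact ⟨k, lt_of_not_ge fun hle => hk (hN k hle), rfl⟩

/-- A point other than the chosen limits has a neighbourhood that meets each of the finitely many
ranges in a finite set. -/
theorem MemConv.finite_accPts {S : Set ratUnit} (h : MemConv S) : (accPts S).Finite := by
  obtain ⟨m, s, hs, hS⟩ := h
  choose p hp using hs
  refine (finite_range p).subset fun r hr => ?_
  by_contra hrp
  have hne : ∀ i, r ≠ p i := fun i hi => hrp ⟨i, hi.symm⟩
  choose U V hU hV hUV using fun i => t2_separation_nhds (hne i)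
  refine hr (⋂ i, U i) (iInter_mem.2 hU)
    ((finite_iUnion fun i => finite_range_diff_of_tendsto (hp i) (hV i)).subset ?_)
  rintro q ⟨hqS, hqU⟩
  obtain ⟨i, hi⟩ := mem_iUnion.1 (hS hqS)
  exact mem_iUnion.2 ⟨i, hi, disjoint_left.1 (hUV i) (mem_iInter.1 hqU i)⟩

theorem memConv_of_tendsto {ι : Type*} [Finite ι] (s : ι → ℕ → ratUnit)
    (hs : ∀ i, ∃ p : unitInterval, Tendsto (fun k => (s i k : unitInterval)) atTop (𝓝 p))
    {S : Set ratUnit} (hS : S ⊆ ⋃ i, range (s i)) : MemConv S := by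
  obtain ⟨n, ⟨e⟩⟩ := Finite.exists_equiv_fin ι
  refine ⟨n, fun i => s (e.symm i), fun i => hs _, hS.trans ?_⟩
  exact iUnion_subset fun i => by
    have := subset_iUnion (fun j => range (s (e.symm j))) (e i)
    simpa using this

theorem Set.Finite.memConv {S : Set ratUnit} (hS : S.Finite) : MemConv S := by
  have := hS.to_subtype
  exact memConv_of_tendsto (fun (q : S) _ => (q : ratUnit)) (fun q => ⟨_, tendsto_const_nhds⟩)
    fun q hq => mem_iUnion.2 ⟨⟨q, hq⟩, 0, rfl⟩

theorem MemConv.biUnion {ι : Type*} {I : Set ι} (hI : I.Finite) {S : ι → Set ratUnit}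
    (h : ∀ i ∈ I, MemConv (S i)) : MemConv (⋃ i ∈ I, S i) := by
  choose m s hs hS using fun i : I => h i i.2
  have := hI.to_subtype
  refine memConv_of_tendsto (fun j : (Σ i : I, Fin (m i)) => s j.1 j.2) (fun j => hs j.1 j.2) ?_
  refine iUnion₂_subset fun i hi q hq => ?_
  obtain ⟨k, hk⟩ := mem_iUnion.1 (hS ⟨i, hi⟩ hq)
  exact mem_iUnion.2 ⟨⟨⟨i, hi⟩, k⟩, hk⟩

/-- A set all but finitely many of whose elements lie in any given neighbourhood of `p` is in the
ideal `conv`. -/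
theorem memConv_of_finite_diff {S : Set ratUnit} (p : unitInterval)
    (h : ∀ U ∈ 𝓝 p, {q : ratUnit | q ∈ S ∧ (q : unitInterval) ∉ U}.Finite) : MemConv S := by
  rcases S.finite_or_infinite with hfin | hinf
  · exact hfin.memConv
  have := hinf.to_subtype
  have := countable_ratUnit
  obtain ⟨e⟩ := nonempty_equiv_of_countable (α := ℕ) (β := S)
  refine memConv_of_tendsto (fun (_ : Unit) k => (e k : ratUnit)) (fun _ => ⟨p, ?_⟩) ?_
  · intro U hU
    rw [← Nat.cofinite_eq_atTop, mem_map, mem_cofinite]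
    refine ((h U hU).preimage (f := fun k => (e k : ratUnit))
      (Subtype.val_injective.comp e.injective).injOn).subset fun k hk => ⟨(e k).2, hk⟩
  · intro q hq
    exact mem_iUnion.2 ⟨(), e.symm ⟨q, hq⟩, by simp⟩

/-- Split `S` according to the nearest accumulation point. The piece `N p` can accumulate only at
`p`, because points close to another accumulation point `r` are nearer to `r`. -/
theorem memConv_of_finite_accPts {S : Set ratUnit} (h : (accPts S).Finite) : MemConv S := by
  rcases S.finite_or_infinite with hfin | hinf
  · exact hfin.memConv
  have hne : (accPts S).Nonempty := exists_mem_accPts hinf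
  let N : unitInterval → Set ratUnit := fun p =>
    {q | q ∈ S ∧ ∀ r ∈ accPts S, dist (q : unitInterval) p ≤ dist (q : unitInterval) r}
  have hN : MemConv (⋃ p ∈ accPts S, N p) := by
    refine MemConv.biUnion h fun p _ => memConv_of_finite_diff p fun U hU => ?_
    by_contra hinf'
    obtain ⟨r, hr⟩ := exists_mem_accPts hinf'
    have hrS : r ∈ accPts S := accPts_mono (fun q hq => hq.1.1) hr
    have hrp : r ≠ p := by
      rintro rfl
      obtain ⟨q, hq, hqU⟩ := (hr U hU).nonempty
      exact hq.2 hqU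
    have hV : {t : unitInterval | dist t r < dist t p} ∈ 𝓝 r := by
      refine (isOpen_lt (by fun_prop) (by fun_prop)).mem_nhds ?_
      simpa using hrp
    obtain ⟨q, hq, hqV⟩ := (hr _ hV).nonempty
    exact absurd (hq.1.2 r hrS) (not_le.2 hqV)
  obtain ⟨m, s, hs, hsub⟩ := hN
  refine ⟨m, s, hs, fun q hq => hsub ?_⟩
  obtain ⟨p, hp, hmin⟩ := h.exists_minimalFor (fun p => dist (q : unitInterval) p) _ hne
  refine mem_iUnion₂.2 ⟨p, hp, hq, fun r hr => ?_⟩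
  rcases le_total (dist (q : unitInterval) p) (dist (q : unitInterval) r) with h | h
  · exact h
  · exact hmin hr h

theorem memConv_iff {S : Set ratUnit} : MemConv S ↔ (accPts S).Finite :=
  ⟨MemConv.finite_accPts, memConv_of_finite_accPts⟩

theorem MemConv.union {S T : Set ratUnit} (hS : MemConv S) (hT : MemConv T) :
    MemConv (S ∪ T) := by
  rw [union_eq_iUnion, ← biUnion_univ]
  exact MemConv.biUnion finite_univ fun b _ => by cases b <;> assumption

theorem MemConv.mono {S T : Set ratUnit} (hT : MemConv T) (h : S ⊆ T) : MemConv S := by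
  obtain ⟨m, s, hs, hT⟩ := hT
  exact ⟨m, s, hs, h.trans hT⟩

/-! ### Construction of spread injections -/

/-- Row `n` reserves infinitely many slots, those with second coordinate `Nat.pair k j`, for each
basic open set `b k`. Filling them from `C n ∩ b k` whenever this is infinite makes the row
accumulate wherever `C n` does. -/
theorem exists_mem_spreadInjections {C : ℕ → Set ratUnit} (hinf : ∀ n, (accPts (C n)).Infinite)
    (hsp : ∀ p : unitInterval, ∃ V ∈ 𝓝 p, ∀ n, ∃ q ∈ accPts (C n), q ∉ V) :
    ∃ x ∈ spreadInjections, ∀ z, x z ∈ C z.1 := by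
  classical
  obtain ⟨b, hb⟩ := (TopologicalSpace.countable_countableBasis unitInterval).exists_eq_range
    (((TopologicalSpace.isBasis_countableBasis unitInterval).mem_nhds_iff.1
      (univ_mem (f := 𝓝 0))).imp fun _ h => h.1)
  have hbasis := TopologicalSpace.isBasis_countableBasis unitInterval
  rw [hb] at hbasis
  let W : ℕ × ℕ → Set ratUnit := fun z =>
    {q | q ∈ C z.1 ∧ (q : unitInterval) ∈ b (Nat.unpair z.2).1}
  -- The fallback `C z.1` only keeps every choice set infinite.
  let T : ℕ × ℕ → Set ratUnit := fun z => if (W z).Infinite then W z else C z.1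
  have hT : ∀ z, (T z).Infinite := by
    intro z
    by_cases h : (W z).Infinite
    · simpa only [T, if_pos h] using h
    · simp only [T, if_neg h]
      obtain ⟨p, hp⟩ := (hinf z.1).nonempty
      exact (hp univ univ_mem).mono fun q hq => hq.1
  obtain ⟨x, hx, hxT⟩ := exists_injective_mem_of_infinite hT
  have hxC : ∀ z, x z ∈ C z.1 := by
    intro z
    have := hxT z
    simp only [T] at this
    split_ifs at this
    · exact this.1
    · exact this
  have hacc : ∀ n, accPts (C n) ⊆ accPts (range fun j => x (n, j)) := by
    intro n p hp U hU
    obtain ⟨_, ⟨k, rfl⟩, hpk, hkU⟩ := hbasis.mem_nhds_iff.1 hU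
    have hk : {q : ratUnit | q ∈ C n ∧ (q : unitInterval) ∈ b k}.Infinite :=
      hp _ ((hbasis.isOpen (mem_range_self k)).mem_nhds hpk)
    have hinj : Function.Injective fun j => x (n, Nat.pair k j) := by
      intro i j hij
      simpa using hx hij
    refine (infinite_range_of_injective hinj).mono ?_
    rintro _ ⟨j, rfl⟩
    refine ⟨⟨_, rfl⟩, hkU ?_⟩
    have := hxT (n, Nat.pair k j)
    simp only [T, W, Nat.unpair_pair] at this
    rw [if_pos hk] at this
    exact this.2
  refine ⟨x, ⟨fun p => ?_, hx, fun n hn => ?_⟩, hxC⟩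
  · obtain ⟨V, hV, hVn⟩ := hsp p
    -- Closedness makes the complement of `V'` a neighbourhood of any accumulation point outside
    -- `V`, so it contains terms of the row.
    obtain ⟨V', hV', hcl, hsub⟩ := exists_mem_nhds_isClosed_subset hV
    refine ⟨V', hV', fun n hn => ?_⟩
    obtain ⟨q, hq, hqV⟩ := hVn (n + 1)
    obtain ⟨_, ⟨j, rfl⟩, hj⟩ := (hacc _ hq _
      (hcl.isOpen_compl.mem_nhds fun h => hqV (hsub h))).nonempty
    exact hj (hn ⟨(n + 1, j), Nat.lt_succ_self n, rfl⟩)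
  · refine hinf (n + 1) (hn.finite_accPts.subset ((hacc _).trans (accPts_mono ?_)))
    rintro _ ⟨j, rfl⟩
    exact ⟨(n + 1, j), Nat.lt_succ_self n, rfl⟩

theorem exists_mem_spreadInjections_range_subset {D : Set ratUnit} (hD : ¬ MemConv D) :
    ∃ x ∈ spreadInjections, range x ⊆ D := by
  rw [memConv_iff] at hD
  obtain ⟨x, hx, hxD⟩ := exists_mem_spreadInjections (C := fun _ => D) (fun _ => hD) fun p => by
    obtain ⟨q, hq, hqp⟩ := Set.Infinite.exists_notMem_finite hD (finite_singleton p)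
    exact ⟨{q}ᶜ, isOpen_compl_singleton.mem_nhds fun h => hqp h.symm, fun _ => ⟨q, hq, by simp⟩⟩
  exact ⟨x, hx, by rintro _ ⟨z, rfl⟩; exact hxD z⟩

theorem not_memConv_univ : ¬ MemConv univ := by
  rw [memConv_iff, accPts_univ]
  exact infinite_of_mem_nhds (0 : unitInterval) univ_mem

/-! ### `FinBW` for partition regular functions -/

namespace FamilyMap

variable {Ω Λ : Type*} {ρ : FamilyMap Ω Λ}

theorem FinBW.of_surjective {Y Z : Type*} [TopologicalSpace Y] [TopologicalSpace Z]
    (h : ρ.FinBW Y) {g : Y → Z} (hg : Continuous g) (hs : Function.Surjective g) :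
    ρ.FinBW Z := by
  intro f
  obtain ⟨F, hF, y, hy⟩ := h (fun a => Function.surjInv hs (f a))
  refine ⟨F, hF, g y, fun U hU => ?_⟩
  obtain ⟨K, hK, hsub⟩ := hy _ (hg.continuousAt.preimage_mem_nhds hU)
  refine ⟨K, hK, ?_⟩
  rintro _ ⟨a, ha, rfl⟩
  have := hsub ⟨a, ha, rfl⟩
  rwa [mem_preimage, Function.surjInv_eq hs] at this

namespace IsPartitionRegular

theorem nonempty_map_diff (h : ρ.IsPartitionRegular) {F : Set Ω} (hF : F ∈ ρ.dom) {K : Set Ω}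
    (hK : K.Finite) : (ρ.map (F \ K)).Nonempty :=
  (h.map_infinite _ (h.diff_mem F hF K hK)).nonempty

theorem map_diff_subset (h : ρ.IsPartitionRegular) {E F : Set Ω} (hE : E ∈ ρ.dom)
    (hF : F ∈ ρ.dom) (hEF : E ⊆ F) {K L : Set Ω} (hK : K.Finite) (hL : L.Finite) (hLK : L ⊆ K) :
    ρ.map (E \ K) ⊆ ρ.map (F \ L) :=
  h.mono _ (h.diff_mem E hE K hK) _ (h.diff_mem F hF L hL) (sdiff_subset_sdiff hEF hLK)

theorem finBW_of_isClosedEmbedding (h : ρ.IsPartitionRegular) {Y Z : Type*} [TopologicalSpace Y]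
    [TopologicalSpace Z] (hZ : ρ.FinBW Z) {e : Y → Z} (he : IsClosedEmbedding e) :
    ρ.FinBW Y := by
  intro f
  obtain ⟨F, hF, z, hz⟩ := hZ (e ∘ f)
  have hcl : z ∈ range e := by
    rw [← he.isClosed_range.closure_eq, mem_closure_iff_nhds]
    intro U hU
    obtain ⟨K, hK, hsub⟩ := hz U hU
    obtain ⟨a, ha⟩ := h.nonempty_map_diff hF hK
    exact ⟨e (f a), hsub ⟨a, ha, rfl⟩, f a, rfl⟩
  obtain ⟨y, rfl⟩ := hcl
  refine ⟨F, hF, y, fun U hU => ?_⟩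
  rw [he.isInducing.nhds_eq_comap] at hU
  obtain ⟨V, hV, hVU⟩ := hU
  obtain ⟨K, hK, hsub⟩ := hz V hV
  refine ⟨K, hK, ?_⟩
  rintro _ ⟨a, ha, rfl⟩
  exact hVU (hsub ⟨a, ha, rfl⟩)

/-- A `ρ`-limit of a sequence indexed through `Λ ≃ ℕ` is a cluster point, since the sets `ρ(F ∖ K)`
are infinite. -/
theorem compactSpace_of_finBW (h : ρ.IsPartitionRegular) {Y : Type*} [MetricSpace Y]
    (hY : ρ.FinBW Y) : CompactSpace Y := by
  have := h.countable_target
  have := h.infinite_target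
  obtain ⟨e⟩ := nonempty_equiv_of_countable (α := Λ) (β := ℕ)
  rw [compactSpace_iff_seqCompactSpace]
  refine ⟨fun u _ => ?_⟩
  obtain ⟨F, hF, y, hy⟩ := hY (u ∘ e)
  refine ⟨y, trivial, MapClusterPt.tendsto_subseq (mapClusterPt_iff_frequently.2 fun U hU => ?_)⟩
  obtain ⟨K, hK, hsub⟩ := hy U hU
  rw [Nat.frequently_atTop_iff_infinite]
  refine ((h.map_infinite _ (h.diff_mem F hF K hK)).image e.injective.injOn).mono ?_
  rintro _ ⟨a, ha, rfl⟩
  exact hsub ⟨a, ha, rfl⟩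

/-- The Cantor set is closed in `[0,1]` and maps continuously onto every nonempty compact metric
space. -/
theorem finBW_of_compactSpace (h : ρ.IsPartitionRegular) (hI : ρ.FinBW unitInterval)
    (Y : Type*) [MetricSpace Y] [CompactSpace Y] : ρ.FinBW Y := by
  have := h.infinite_target
  rcases isEmpty_or_nonempty Y with hY | hY
  · intro f
    exact hY.elim (f (Classical.arbitrary Λ))
  obtain ⟨g, hg, hs⟩ := exists_nat_bool_continuous_surjective_of_compact Y
  have he : IsClosedEmbedding (Set.inclusion cantorSet_subset_unitInterval) :=
    IsClosedEmbedding.inclusion cantorSet_subset_unitInterval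
      (isClosed_cantorSet.preimage continuous_subtype_val)
  exact (h.finBW_of_isClosedEmbedding hI he).of_surjective
    (hg.comp cantorSetHomeomorphNatToBool.continuous)
    (hs.comp cantorSetHomeomorphNatToBool.surjective)

/-- Every finite set of values is eventually avoided along some smaller member of the domain. -/
theorem exists_disjoint_finite (h : ρ.IsPartitionRegular) {E : Set Ω} (hE : E ∈ ρ.dom) :
    ∃ F ∈ ρ.dom, F ⊆ E ∧
      ∀ S : Set Λ, S.Finite → ∃ K : Set Ω, K.Finite ∧ Disjoint (ρ.map (F \ K)) S := by
  obtain ⟨F, hF, hFE, hs⟩ := h.sparse E hE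
  refine ⟨F, hF, hFE, fun S hS => ?_⟩
  induction S, hS using Set.Finite.induction_on with
  | empty => exact ⟨∅, finite_empty, disjoint_bot_right⟩
  | @insert a S _ _ ih =>
    obtain ⟨K, hK, hd⟩ := ih
    obtain ⟨L, hL, haL⟩ : ∃ L : Set Ω, L.Finite ∧ a ∉ ρ.map (F \ L) := by
      by_cases ha : a ∈ ρ.map F
      · exact hs a ha
      · exact ⟨∅, finite_empty, by simpa using ha⟩
    refine ⟨K ∪ L, hK.union hL, disjoint_insert_right.2 ⟨fun hmem => haL ?_, hd.mono_left ?_⟩⟩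
    · exact h.map_diff_subset hF hF le_rfl (hK.union hL) hL subset_union_right hmem
    · exact h.map_diff_subset hF hF le_rfl (hK.union hL) hK subset_union_left

theorem exists_map_subset_of_subset_iUnion (h : ρ.IsPartitionRegular) {m : ℕ} :
    ∀ {F : Set Ω}, F ∈ ρ.dom → ∀ S : Fin m → Set Λ, ρ.map F ⊆ ⋃ i, S i →
      ∃ E ∈ ρ.dom, ∃ i, ρ.map E ⊆ S i := by
  induction m with
  | zero =>
    intro F hF S hS
    obtain ⟨a, ha⟩ := (h.map_infinite F hF).nonempty
    obtain ⟨i, _⟩ := mem_iUnion.1 (hS ha)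
    exact i.elim0
  | succ m ih =>
    intro F hF S hS
    obtain ⟨E, hE, hE' | hE'⟩ := h.regular F hF (ρ.map F ∩ S 0) (ρ.map F \ S 0)
      (inter_union_sdiff _ _).symm
    · exact ⟨E, hE, 0, hE'.trans inter_subset_right⟩
    · obtain ⟨E₁, hE₁, i, hi⟩ := ih hE (fun i => S i.succ) fun a ha => by
        obtain ⟨i, hi⟩ := mem_iUnion.1 (hS (hE' ha).1)
        cases i using Fin.cases with
        | zero => exact absurd hi (hE' ha).2
        | succ i => exact mem_iUnion.2 ⟨i, hi⟩
      exact ⟨E₁, hE₁, i.succ, hi⟩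

/-- If `[0,1] ∉ FinBW(ρ)`, this is witnessed by an injection into the rationals. -/
theorem exists_injective_of_not_finBW (h : ρ.IsPartitionRegular)
    (hI : ¬ ρ.FinBW unitInterval) : ∃ g : Λ → ratUnit, Function.Injective g ∧
      ∀ F ∈ ρ.dom, ∀ y, ¬ ρ.ConvergesTo (fun a => (g a : unitInterval)) F y := by
  have := h.countable_target
  obtain ⟨e, he⟩ := exists_injective_nat Λ
  simp only [FinBW, not_forall, not_exists, not_and] at hI
  obtain ⟨f, hf⟩ := hI
  -- The radii tend to `0` along the enumeration `e`, so `f` and `g` differ by at least a given `ε`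
  -- at only finitely many points. Thinning by (S) discards these.
  have hT : ∀ a : Λ,
      {q : ratUnit | q ∈ univ ∧ (q : unitInterval) ∈ Metric.ball (f a) (1 / (e a + 1))}.Infinite :=
    fun a => (accPts_univ.symm ▸ mem_univ (f a) : f a ∈ accPts univ) _
      (Metric.ball_mem_nhds _ Nat.one_div_pos_of_nat)
  obtain ⟨g, hg, hgT⟩ := exists_injective_mem_of_infinite hT
  refine ⟨g, hg, fun F hF y hy => ?_⟩
  obtain ⟨F', hF', hsub, hd⟩ := h.exists_disjoint_finite hF
  refine hf F' hF' y fun U hU => ?_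
  obtain ⟨ε, hε, hεU⟩ := Metric.mem_nhds_iff.1 hU
  obtain ⟨n, hn⟩ := exists_nat_one_div_lt (half_pos hε)
  obtain ⟨K, hK, hKsub⟩ := hy _ (Metric.ball_mem_nhds y (half_pos hε))
  obtain ⟨L, hL, hLd⟩ := hd (e ⁻¹' Iio n) ((finite_Iio n).preimage he.injOn)
  refine ⟨K ∪ L, hK.union hL, ?_⟩
  rintro _ ⟨a, ha, rfl⟩
  have h1 : dist (g a : unitInterval) y < ε / 2 :=
    hKsub ⟨a, h.map_diff_subset hF' hF hsub (hK.union hL) hK subset_union_left ha, rfl⟩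
  have h2 : dist (g a : unitInterval) (f a) < 1 / (e a + 1) := (hgT a).2
  have h3 : n ≤ e a := not_lt.1 fun hlt => disjoint_left.1 hLd
    (h.map_diff_subset hF' hF' le_rfl (hK.union hL) hL subset_union_right ha) hlt
  have h4 := Nat.one_div_le_one_div (α := ℝ) h3
  refine hεU ?_
  rw [Metric.mem_ball]
  have := dist_triangle_left (f a) y (g a : unitInterval)
  linarith

/-- By (R), a finite cover by convergent sequences leaves some `g[ρ(E)]` inside one of them. A
thinning of `E` then avoids the finitely many terms outside any neighbourhood of the limit, so `g`
converges along it. -/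
theorem not_memConv_image (h : ρ.IsPartitionRegular) {g : Λ → ratUnit}
    (hg : Function.Injective g)
    (hconv : ∀ F ∈ ρ.dom, ∀ y, ¬ ρ.ConvergesTo (fun a => (g a : unitInterval)) F y)
    {F : Set Ω} (hF : F ∈ ρ.dom) : ¬ MemConv (g '' ρ.map F) := by
  rintro ⟨m, s, hs, hsub⟩
  obtain ⟨E, hE, i, hi⟩ := h.exists_map_subset_of_subset_iUnion hF (fun i => g ⁻¹' range (s i))
    fun a ha => by simpa using hsub ⟨a, ha, rfl⟩
  obtain ⟨p, hp⟩ := hs i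
  obtain ⟨E', hE', hsub', hd⟩ := h.exists_disjoint_finite hE
  refine hconv E' hE' p fun U hU => ?_
  obtain ⟨K, hK, hKd⟩ := hd _ ((finite_range_diff_of_tendsto hp hU).preimage hg.injOn)
  refine ⟨K, hK, ?_⟩
  rintro _ ⟨a, ha, rfl⟩
  by_contra haU
  refine disjoint_left.1 hKd ha ⟨hi ?_, haU⟩
  have := h.map_diff_subset hE' hE hsub' hK finite_empty (empty_subset K) ha
  simpa using this

/-- If `g` has no `ρ`-convergent restriction, some spread injection runs through the tails of the
image of any given `ρ.map F`. -/
theorem exists_mem_spreadInjections_tails (h : ρ.IsPartitionRegular) {g : Λ → ratUnit}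
    (hg : Function.Injective g)
    (hconv : ∀ F ∈ ρ.dom, ∀ y, ¬ ρ.ConvergesTo (fun a => (g a : unitInterval)) F y)
    {F : Set Ω} (hF : F ∈ ρ.dom) : ∃ x ∈ spreadInjections, ∀ K : Set Ω, K.Finite →
      ∃ n : ℕ, ∀ z : ℕ × ℕ, n ≤ z.1 → x z ∈ g '' ρ.map (F \ K) := by
  have := h.countable_source
  obtain ⟨e, he⟩ := exists_injective_nat Ω
  obtain ⟨E, hE, hEF, hd⟩ := h.exists_disjoint_finite hF
  have hfin : ∀ n : ℕ, (e ⁻¹' Iio n).Finite := fun n => (finite_Iio n).preimage he.injOn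
  have hex : ∀ K : Set Ω, K.Finite → ∃ n, K ⊆ e ⁻¹' Iio n := fun K hK => by
    obtain ⟨n, hn⟩ := (hK.image e).bddAbove
    exact ⟨n + 1, fun a ha => Nat.lt_succ_of_le (hn ⟨a, ha, rfl⟩)⟩
  let C : ℕ → Set ratUnit := fun n => g '' ρ.map (E \ e ⁻¹' Iio n)
  have hC : Antitone C := fun m n hmn => image_mono <|
    h.map_diff_subset hE hE le_rfl (hfin n) (hfin m) fun a (ha : e a < m) => ha.trans_le hmn
  have hinf : ∀ n, (accPts (C n)).Infinite := fun n hn =>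
    h.not_memConv_image hg hconv (h.diff_mem E hE _ (hfin n)) (memConv_iff.2 hn)
  obtain ⟨x, hx, hxC⟩ := exists_mem_spreadInjections hinf fun p => by
    have hp := hconv E hE p
    simp only [ConvergesTo, not_forall, not_exists, not_and] at hp
    obtain ⟨U, hU, hUK⟩ := hp
    obtain ⟨V, hV, hVo, hpV⟩ := mem_nhds_iff.1 hU
    refine ⟨V, hVo.mem_nhds hpV, fun n => ?_⟩
    -- Were this set finite, removing its preimage would put a whole tail inside `V`. Since `V` is
    -- open, an accumulation point of the set stays outside `V`.
    have hS : {q : ratUnit | q ∈ C n ∧ (q : unitInterval) ∉ V}.Infinite := by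
      intro hS
      obtain ⟨K, hK, hKd⟩ := hd _ (hS.preimage hg.injOn)
      refine hUK (K ∪ e ⁻¹' Iio n) (hK.union (hfin n)) ?_
      rintro _ ⟨a, ha, rfl⟩
      by_contra haU
      refine disjoint_left.1 hKd
        (h.map_diff_subset hE hE le_rfl (hK.union (hfin n)) hK subset_union_left ha)
        ⟨⟨a, h.map_diff_subset hE hE le_rfl (hK.union (hfin n)) (hfin n) subset_union_right ha,
          rfl⟩, fun haV => haU (hV haV)⟩
    obtain ⟨q, hq⟩ := exists_mem_accPts hS
    refine ⟨q, accPts_mono (fun _ h => h.1) hq, fun hqV => ?_⟩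
    obtain ⟨r, hr, hrV⟩ := (hq V (hVo.mem_nhds hqV)).nonempty
    exact hr.2 hrV
  refine ⟨x, hx, fun K hK => ?_⟩
  obtain ⟨n, hn⟩ := hex K hK
  exact ⟨n, fun z hz => image_mono (h.map_diff_subset hE hF hEF (hfin n) hK hn) (hC hz (hxC z))⟩

end IsPartitionRegular

end FamilyMap

/-! ### Partition regularity of `ρ^{[0,1]}` and the Katětov order -/

section rhoUnit

variable {ι : Type*} {A : ι → Set ℕ} {x : ι → ℕ × ℕ → ratUnit}

theorem self_mem_rhoUnit_dom (α : ι) : A α ∈ (rhoUnit A x).dom :=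
  ⟨α, ∅, finite_empty, by simp⟩

theorem rhoUnit_map_self (hA : IsAlmostDisjointFamily A) (α : ι) :
    (rhoUnit A x).map (A α) = range (x α) := by
  have := rhoUnit_map_diff hA x α finite_empty
  simpa using this

theorem tail_subset_rhoUnit_map (hA : IsAlmostDisjointFamily A) (α : ι) {K : Set ℕ}
    (hK : K.Finite) : ∃ n : ℕ, x α '' {z | n < z.1} ⊆ (rhoUnit A x).map (A α \ K) := by
  obtain ⟨n, hn⟩ := hK.bddAbove
  refine ⟨n, ?_⟩
  rw [rhoUnit_map_diff hA x α hK]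
  exact image_mono fun z hz m hm => (hn hm.2).trans_lt hz

theorem rhoUnit_isPartitionRegular (hA : IsAlmostDisjointFamily A)
    (hx : range x = spreadInjections) : (rhoUnit A x).IsPartitionRegular where
  countable_source := inferInstance
  infinite_source := inferInstance
  countable_target := countable_ratUnit
  infinite_target := by
    rw [← infinite_univ_iff]
    exact fun h => not_memConv_univ h.memConv
  dom_nonempty := by
    obtain ⟨y, hy, _⟩ := exists_mem_spreadInjections_range_subset not_memConv_univ
    rw [← hx] at hy
    obtain ⟨α, rfl⟩ := hy
    exact ⟨A α, self_mem_rhoUnit_dom α⟩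
  infinite_of_mem := by
    rintro _ ⟨α, K, hK, rfl⟩
    exact (hA.1 α).sdiff hK
  diff_mem := by
    rintro _ ⟨α, K, hK, rfl⟩ L hL
    exact ⟨α, K ∪ L, hK.union hL, sdiff_sdiff⟩
  map_infinite := by
    rintro _ ⟨α, K, hK, rfl⟩ hfin
    obtain ⟨n, hn⟩ := tail_subset_rhoUnit_map (x := x) hA α hK
    have hxα : x α ∈ spreadInjections := hx ▸ mem_range_self α
    exact hxα.2.2 n (hfin.subset hn).memConv
  mono := by
    rintro _ ⟨α, K, hK, rfl⟩ _ ⟨β, L, hL, rfl⟩ hsub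
    have hαβ : α = β := by
      by_contra hne
      exact ((hA.1 α).sdiff hK) ((hA.2 α β hne).subset fun m hm => ⟨hm.1, (hsub hm).1⟩)
    subst hαβ
    rw [rhoUnit_map_diff hA x α hK, rhoUnit_map_diff hA x α hL]
    refine image_mono fun z hz m hm => hz m ⟨hm.1, ?_⟩
    by_contra hmK
    exact (hsub ⟨hm.1, hmK⟩).2 hm.2
  regular := by
    rintro _ ⟨α, K, hK, rfl⟩ B C hBC
    obtain ⟨n, hn⟩ := tail_subset_rhoUnit_map (x := x) hA α hK
    have hxα : x α ∈ spreadInjections := hx ▸ mem_range_self α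
    -- As `conv` is an ideal, one of `B`, `C` lies outside it and so contains the range of some `x
    -- β`.
    have key : ∀ D, ¬ MemConv D → ∃ E ∈ (rhoUnit A x).dom, (rhoUnit A x).map E ⊆ D := by
      intro D hD
      obtain ⟨y, hy, hyD⟩ := exists_mem_spreadInjections_range_subset hD
      rw [← hx] at hy
      obtain ⟨β, rfl⟩ := hy
      exact ⟨A β, self_mem_rhoUnit_dom β, by rwa [rhoUnit_map_self hA]⟩
    by_cases hB : MemConv B
    · obtain ⟨E, hE, hEC⟩ := key C fun hC => hxα.2.2 n ((hB.union hC).mono (hBC ▸ hn))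
      exact ⟨E, hE, Or.inr hEC⟩
    · obtain ⟨E, hE, hEB⟩ := key B hB
      exact ⟨E, hE, Or.inl hEB⟩
  sparse := by
    rintro _ ⟨α, K, hK, rfl⟩
    have hxα : x α ∈ spreadInjections := hx ▸ mem_range_self α
    refine ⟨_, ⟨α, K, hK, rfl⟩, le_rfl, fun a ha => ?_⟩
    rw [rhoUnit_map_diff hA x α hK] at ha
    obtain ⟨z, -, rfl⟩ := ha
    -- Deleting `m` pushes the first coordinates past `z.1`; by injectivity the value `x α z` is not
    -- attained again.
    obtain ⟨m, hm, hzm⟩ := (hA.1 α).exists_gt z.1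
    refine ⟨{m}, finite_singleton m, ?_⟩
    rw [sdiff_sdiff, rhoUnit_map_diff hA x α (hK.union (finite_singleton m))]
    rintro ⟨w, hw, hwz⟩
    obtain rfl := hxα.2.1 hwz
    exact lt_asymm hzm (hw m ⟨hm, Or.inr rfl⟩)

theorem not_finBW_of_katetovLE (hA : IsAlmostDisjointFamily A)
    (hx : range x = spreadInjections) {Ω Λ : Type*} {ρ : FamilyMap Ω Λ}
    (h : FamilyMap.KatetovLE (rhoUnit A x) ρ) : ¬ ρ.FinBW unitInterval := by
  intro hI
  obtain ⟨f, hf⟩ := h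
  obtain ⟨F, hF, p, hp⟩ := hI fun a => (f a : unitInterval)
  obtain ⟨_, ⟨α, L, hL, rfl⟩, hα⟩ := hf F hF
  have hxα : x α ∈ spreadInjections := hx ▸ mem_range_self α
  obtain ⟨U, hU, hUn⟩ := hxα.1 p
  obtain ⟨K, hK, hKU⟩ := hp U hU
  obtain ⟨M, hM, hMf⟩ := hα K hK
  obtain ⟨n, hn⟩ := tail_subset_rhoUnit_map (x := x) hA α (hL.union hM)
  rw [sdiff_sdiff] at hMf
  refine hUn n ?_
  rintro _ ⟨z, hz, rfl⟩
  obtain ⟨a, ha, hza⟩ := hMf (hn ⟨z, hz, rfl⟩)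
  exact hKU ⟨a, ha, congrArg Subtype.val hza⟩

theorem katetovLE_of_not_finBW (hA : IsAlmostDisjointFamily A)
    (hx : range x = spreadInjections) {Ω Λ : Type*} {ρ : FamilyMap Ω Λ}
    (h : ρ.IsPartitionRegular) (hI : ¬ ρ.FinBW unitInterval) :
    FamilyMap.KatetovLE (rhoUnit A x) ρ := by
  obtain ⟨g, hg, hconv⟩ := h.exists_injective_of_not_finBW hI
  refine ⟨g, fun F hF => ?_⟩
  obtain ⟨y, hy, hyF⟩ := h.exists_mem_spreadInjections_tails hg hconv hF
  rw [← hx] at hy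
  obtain ⟨α, rfl⟩ := hy
  refine ⟨A α, self_mem_rhoUnit_dom α, fun K hK => ?_⟩
  obtain ⟨n, hn⟩ := hyF K hK
  -- Since `A α` is infinite, removing a single large element already cuts off the first `n` rows.
  obtain ⟨m, hm, hnm⟩ := (hA.1 α).exists_gt n
  refine ⟨{m}, finite_singleton m, ?_⟩
  rw [rhoUnit_map_diff hA x α (finite_singleton m)]
  rintro _ ⟨z, hz, rfl⟩
  exact hn z (hnm.trans (hz m ⟨hm, rfl⟩)).le

end rhoUnit

theorem mainTheorem4 {ι : Type*} (A : ι → Set ℕ) (hA : IsAlmostDisjointFamily A)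
    (x : ι → ℕ × ℕ → ratUnit) (hx : Set.range x = spreadInjections) :
    (rhoUnit A x).IsPartitionRegular ∧
    ∀ {Ω Λ : Type*} (ρ : FamilyMap Ω Λ), ρ.IsPartitionRegular →
      List.TFAE [
        ∀ (Y : Type*) [MetricSpace Y], ρ.FinBW Y ↔ CompactSpace Y,
        ρ.FinBW unitInterval,
        ¬ FamilyMap.KatetovLE (rhoUnit A x) ρ] := by
  refine ⟨rhoUnit_isPartitionRegular hA hx, fun ρ h => ?_⟩
  -- `ULift` moves `[0,1]` to the universe over which `Y` ranges.
  tfae_have 1 → 2 := fun H =>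
    ((H (ULift unitInterval)).2 inferInstance).of_surjective continuous_uliftDown
      ULift.down_surjective
  tfae_have 2 → 1 := fun hI Y _ =>
    ⟨h.compactSpace_of_finBW, fun _ => h.finBW_of_compactSpace hI Y⟩
  tfae_have 2 → 3 := fun hI hK => not_finBW_of_katetovLE hA hx hK hI
  tfae_have 3 → 2 := fun hK => by
    by_contra hI
    exact hK (katetovLE_of_not_finBW hA hx h hI)
  tfae_finish
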